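/- **Setting.** A finite MDP has finite nonempty sets $S$ of states and $A$ of actions, a reward function $R:S\times A\to\mathbb R$, transition distributions $T(\cdot\mid s,a)$ on $S$, a discount factor $\gamma\in[0,1)$, and a (possibly empty) set of terminal states; acting in a terminal state yields its reward, after which the episode ends. For a policy $\pi:S\to\Delta(A)$ write $R(s,\pi(s))=\sum_a\pi(a\mid s)R(s,a)$ and $T(s'\mid s,\pi(s))=\sum_a\pi(a\mid s)T(s'\mid s,a)$ (this last quantity being replaced by $0$ if $s$ is terminal). Let $V^\pi$ be the expected discounted return of $\pi$, let $V^*=\sup_\pi V^\pi$, and let $\pi^*$ be any optimal policy. Let $\phi:S\to S_\phi$ be a state abstraction, with $S_\phi$ finite. We write $s\in x$ for $\phi(s)=x$. A *$\phi$-relative option* for $x\in S_\phi$ is an option $o$ with initiation set $\{s: s\in x\}$, with termination probability $\beta_o(s)=\mathbf 1\{s\notin x\}$ on arrival in $s$, and with a policy $\pi_o:\{s:s\in x\}\to\Delta(A)$. Let $O_\phi$ be a nonempty, possibly infinite, set of $\phi$-relative options that contains at least one option for each $x\in S_\phi$. An abstract policy $\mu$ assigns to each $x$ an option of $O_\phi$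 for $x$; it induces the ground policy $\mu^{\Downarrow}(s)=\pi_{\mu(\phi(s))}(s)$. The *value loss* is $L(\phi,O_\phi)=\inf_\mu\|V^*-V^{\mu^\Downarrow}\|_\infty$. Let $o^*_x$ be the $\phi$-relative option for $x$ that executes $\pi^*$. For an option $o$ for $x$ let $Q^*_x(\cdot,o)$ be the solution of $$Q^*_x(s,o)=R(s,\pi_o(s))+\gamma\sum_{s'}T(s'\mid s,\pi_o(s))\big(\mathbf 1\{s'\in x\}Q^*_x(s',o)+\mathbf 1\{s'\notin x\}V^*(s')\big).$$ Let $p(s',k\mid s,o)$ be the probability that $o$, started in $s$, terminates in $s'$ after exactly $k$ steps. Let $T_{s,o}^{s'}=\sum_k\gamma^k p(s',k\mid s,o)$ be its multi-time model, and let $R_{s,o}$ be the expected discounted reward collected until $o$ terminates. **Theorem.** In each of the following four cases $L(\phi,O_\phi)\le B$ for the stated bound $B$, and some abstract policy $\mu$ satisfies $\|V^*-V^{\mu^\Downarrow}\|_\infty\le B$. 1. *(Similar $Q^*$.)* If for each $x\in S_\phi$ some option $o\in O_\phi$ for $x$ satisfies $|Q^*_x(s,o^*_x)-Q^*_x(s,o)|\le\varepsilon_Q$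 for all $s\in x$, then $$B=\frac{\varepsilon_Q}{1-\gamma}.$$ 2. *(Similar models.)* Suppose $|R(s,a)|\le R_{\max}$ for all $s,a$. If for each $x$ some option $o\in O_\phi$ for $x$ satisfies $|T_{s,o^*_x}^{s'}-T_{s,o}^{s'}|\le\varepsilon_T$ and $|R_{s,o^*_x}-R_{s,o}|\le\varepsilon_R$ for all $s\in x$, $s'\in S$, then $$B=\frac{\varepsilon_R+|S|\,\varepsilon_T R_{\max}}{(1-\gamma)^2}.$$ 3. *(Similar $k$-step distributions.)* Suppose the MDP is goal-based: there is a set $S_G\subseteq S$ of goal states such that $R(s,a)=1$ for $s\in S_G$ and $R(s,a)=0$ otherwise, the terminal states are exactly the goal states, and $\phi(s_g)\ne\phi(s)$ whenever $s_g\in S_G$ and $s\neq s_g$. If for each $x$ some option $o\in O_\phi$ for $x$ satisfies $|p(s',k\mid s,o^*_x)-p(s',k\mid s,o)|\le\tau$ for all $k\in\mathbb N$, $s\in x$, $s'\in S$, then $$B=\frac{\tau\gamma|S|}{(1-\gamma)^2}.$$ 4. *(Approximate MDP homomorphisms.)* Suppose there are no terminal states and $0\le R(s,a)\le R_{\max}$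 for all $s,a$. Let $w:S\to[0,1]$ satisfy $\sum_{s\in x}w(s)=1$ for each nonempty abstract state $x$. For $x,y\in S_\phi$ and an option $o$ for $x$ put $T_\phi(y\mid x,o)=\sum_{s\in x}w(s)\sum_{s'\in y}T(s'\mid s,\pi_o(s))$ and $R_\phi(x,o)=\sum_{s\in x}w(s)R(s,\pi_o(s))$. If every abstract policy $\mu$ satisfies $$\max_{s,a}\sum_{y\in S_\phi}\Big|\sum_{s'\in y}T(s'\mid s,a)-T_\phi(y\mid\phi(s),\mu(\phi(s)))\Big|\le\varepsilon_p,\qquad \max_{s,a}\big|R(s,a)-R_\phi(\phi(s),\mu(\phi(s)))\big|\le\varepsilon_r,$$ then $$B=\frac{2}{1-\gamma}\Big(\varepsilon_r+\frac{\gamma R_{\max}}{1-\gamma}\cdot\frac{\varepsilon_p}{2}\Big).$$ -/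

import Mathlib

open scoped Matrix

/-- `Σ_{t ≥ 0} γ^t (P^t c)(s)`: the expected discounted sum of the payoff `c` collected along the
chain with (sub)stochastic transition matrix `P`, started in `s`. -/
noncomputable def discountedSum {S : Type*} [Fintype S] [DecidableEq S]
    (γ : ℝ) (P : Matrix S S ℝ) (c : S → ℝ) (s : S) : ℝ :=
  ∑' t : ℕ, γ ^ t * ((P ^ t) *ᵥ c) s

/-- Nonnegative entries and row sums at most one. -/
def IsSubstochastic {S : Type*} [Fintype S] (P : Matrix S S ℝ) : Prop :=
  (∀ s s', 0 ≤ P s s') ∧ ∀ s, ∑ s', P s s' ≤ 1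

theorem IsSubstochastic.abs_mulVec_le {S : Type*} [Fintype S] {P : Matrix S S ℝ}
    (hP : IsSubstochastic P) {v : S → ℝ} {C : ℝ} (hC : 0 ≤ C) (hv : ∀ s, |v s| ≤ C) (s : S) :
    |(P *ᵥ v) s| ≤ C := by
  calc |(P *ᵥ v) s| = |∑ s', P s s' * v s'| := rfl
    _ ≤ ∑ s', |P s s' * v s'| := Finset.abs_sum_le_sum_abs _ _
    _ ≤ ∑ s', P s s' * C := by
        refine Finset.sum_le_sum fun s' _ => ?_
        rw [abs_mul, abs_of_nonneg (hP.1 s s')]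
        exact mul_le_mul_of_nonneg_left (hv s') (hP.1 s s')
    _ = (∑ s', P s s') * C := by rw [Finset.sum_mul]
    _ ≤ 1 * C := mul_le_mul_of_nonneg_right (hP.2 s) hC
    _ = C := one_mul C

theorem IsSubstochastic.abs_pow_mulVec_le {S : Type*} [Fintype S] [DecidableEq S]
    {P : Matrix S S ℝ} (hP : IsSubstochastic P) {c : S → ℝ} {C : ℝ} (hC : 0 ≤ C)
    (hc : ∀ s, |c s| ≤ C) (t : ℕ) : ∀ s, |((P ^ t) *ᵥ c) s| ≤ C := by
  induction t with
  | zero => simpa using hc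
  | succ t ih =>
    intro s
    rw [pow_succ', ← Matrix.mulVec_mulVec]
    exact hP.abs_mulVec_le hC ih s

theorem summable_discountedSum {S : Type*} [Fintype S] [DecidableEq S] {γ : ℝ} (h0 : 0 ≤ γ)
    (h1 : γ < 1) {P : Matrix S S ℝ} (hP : IsSubstochastic P) (c : S → ℝ) (s : S) :
    Summable fun t : ℕ => γ ^ t * ((P ^ t) *ᵥ c) s := by
  have hc : ∀ s, |c s| ≤ ‖c‖ := fun s => norm_le_pi_norm c s
  refine Summable.of_norm_bounded
    ((summable_geometric_of_lt_one h0 h1).mul_right ‖c‖) fun t => ?_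
  rw [Real.norm_eq_abs, abs_mul, abs_of_nonneg (pow_nonneg h0 t)]
  exact mul_le_mul_of_nonneg_left (hP.abs_pow_mulVec_le (norm_nonneg c) hc t s) (pow_nonneg h0 t)

/-- `discountedSum γ P c` solves the Bellman-type equation `v = c + γ P v`. -/
theorem discountedSum_eq {S : Type*} [Fintype S] [DecidableEq S] {γ : ℝ} (h0 : 0 ≤ γ)
    (h1 : γ < 1) {P : Matrix S S ℝ} (hP : IsSubstochastic P) (c : S → ℝ) (s : S) :
    discountedSum γ P c s = c s + γ * ∑ s', P s s' * discountedSum γ P c s' := by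
  have hs := summable_discountedSum h0 h1 hP c
  unfold discountedSum
  rw [(hs s).tsum_eq_zero_add]
  congr 1
  · simp
  · have : ∀ s', P s s' * ∑' t : ℕ, γ ^ t * ((P ^ t) *ᵥ c) s' =
        ∑' t : ℕ, P s s' * (γ ^ t * ((P ^ t) *ᵥ c) s') := fun s' => tsum_mul_left.symm
    simp_rw [this]
    rw [← Summable.tsum_finsetSum (fun s' _ => (hs s').mul_left _), ← tsum_mul_left]
    refine tsum_congr fun t => ?_
    rw [pow_succ' P, ← Matrix.mulVec_mulVec, pow_succ]
    simp only [Matrix.mulVec, dotProduct, Finset.mul_sum]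
    refine Finset.sum_congr rfl fun s' _ => Finset.sum_congr rfl fun _ _ => by ring

/-- That equation has no other solution. -/
theorem eq_discountedSum {S : Type*} [Fintype S] [DecidableEq S] {γ : ℝ} (h0 : 0 ≤ γ)
    (h1 : γ < 1) {P : Matrix S S ℝ} (hP : IsSubstochastic P) (c v : S → ℝ)
    (hv : ∀ s, v s = c s + γ * ∑ s', P s s' * v s') : v = discountedSum γ P c := by
  set d : S → ℝ := v - discountedSum γ P c with hd
  have hrec : ∀ s, d s = γ * (P *ᵥ d) s := by
    intro s
    simp only [hd, Pi.sub_apply, Matrix.mulVec, dotProduct]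
    rw [hv s, discountedSum_eq h0 h1 hP c s]
    simp only [mul_sub, Finset.sum_sub_distrib]
    ring
  have hle : ‖d‖ ≤ γ * ‖d‖ := by
    refine (pi_norm_le_iff_of_nonneg (mul_nonneg h0 (norm_nonneg d))).2 fun s => ?_
    rw [hrec s, Real.norm_eq_abs, abs_mul, abs_of_nonneg h0]
    exact mul_le_mul_of_nonneg_left
      (hP.abs_mulVec_le (norm_nonneg d) (fun s => norm_le_pi_norm d s) s) h0
  have hz : ‖d‖ = 0 := by nlinarith [norm_nonneg d]
  exact sub_eq_zero.1 (norm_eq_zero.1 hz)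

/-- A finite Markov decision process with rewards `R s a`, transition distributions `T s a` and
discount factor `γ ∈ [0, 1)`. Acting in a state of `terminal` yields its reward and then ends the
episode; an MDP without termination has `terminal = ∅`. -/
structure FiniteMDP (S A : Type*) [Fintype S] where
  R : S → A → ℝ
  T : S → A → stdSimplex ℝ S
  terminal : Finset S
  γ : ℝ
  γ_nonneg : 0 ≤ γ
  γ_lt_one : γ < 1

/-- A (stationary, possibly stochastic) policy `S → Δ(A)`. -/
abbrev Policy (S A : Type*) [Fintype A] : Type _ := S → stdSimplex ℝ A

/-- An option: initiation set, termination probability upon arrival, and policy. -/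
structure MDPOption (S A : Type*) [Fintype A] where
  init : Set S
  β : S → Set.Icc (0 : ℝ) 1
  π : Policy S A

/-- `o` is `φ`-relative, with abstract state `x`: it initiates exactly in the states of `x` and
terminates exactly on arriving outside `x`. The values of `o.π` outside `x` are never used. -/
def IsRelativeTo {S A X : Type*} [Fintype A] [DecidableEq X] (φ : S → X) (x : X)
    (o : MDPOption S A) : Prop :=
  o.init = {s | φ s = x} ∧ ∀ s, (o.β s : ℝ) = if φ s = x then 0 else 1

/-- `O` contains only `φ`-relative options, and at least one for each abstract state. -/
def IsRelativeOptionSet {S A X : Type*} [Fintype A] [DecidableEq X] (φ : S → X)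
    (O : Set (MDPOption S A)) : Prop :=
  O.Nonempty ∧ (∀ o ∈ O, ∃ x, IsRelativeTo φ x o) ∧ ∀ x, ∃ o ∈ O, IsRelativeTo φ x o

/-- Deterministic abstract policies: each abstract state `x` is assigned an option of `O` that
initiates in `x`. -/
def AbstractPolicy {S A X : Type*} [Fintype A] [DecidableEq X] (φ : S → X)
    (O : Set (MDPOption S A)) : Type _ :=
  {μ : X → MDPOption S A // ∀ x, μ x ∈ O ∧ IsRelativeTo φ x (μ x)}

/-- The Markov policy over ground states and actions induced by an abstract policy. -/
def AbstractPolicy.ground {S A X : Type*} [Fintype A] [DecidableEq X] {φ : S → X}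
    {O : Set (MDPOption S A)} (μ : AbstractPolicy φ O) : Policy S A :=
  fun s => (μ.1 (φ s)).π s

/-- The `φ`-relative option that initiates in `x` and executes `π` until it leaves `x`. -/
def relativeOption {S A X : Type*} [Fintype A] [DecidableEq X] (φ : S → X) (π : Policy S A)
    (x : X) : MDPOption S A where
  init := {s | φ s = x}
  β := fun s => if φ s = x then 0 else 1
  π := π

theorem relativeOption_isRelativeTo {S A X : Type*} [Fintype A] [DecidableEq X] (φ : S → X)
    (π : Policy S A) (x : X) : IsRelativeTo φ x (relativeOption φ π x) := by
  refine ⟨rfl, fun s => ?_⟩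
  by_cases h : φ s = x <;> simp [relativeOption, h]

/-- A weighting function: `w : S → [0, 1]` sums to one over each (inhabited) abstract state. -/
def IsWeighting {S X : Type*} [Fintype S] [DecidableEq X] (φ : S → X) (w : S → ℝ) : Prop :=
  (∀ s, w s ∈ Set.Icc (0 : ℝ) 1) ∧ ∀ s, ∑ s' with φ s' = φ s, w s' = 1

namespace FiniteMDP

variable {S A X : Type*} [Fintype S] [DecidableEq S] [Fintype A] [Fintype X] [DecidableEq X]

/-- `T(s' ∣ s, π(s))`, the probability that one step under `π` leads from `s` to `s'`
(zero if the episode ends after `s`). -/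
noncomputable def trans (M : FiniteMDP S A) (π : Policy S A) : Matrix S S ℝ :=
  Matrix.of fun s s' => if s ∈ M.terminal then 0 else ∑ a, (π s).1 a * (M.T s a).1 s'

/-- `R(s, π(s))`. -/
noncomputable def rew (M : FiniteMDP S A) (π : Policy S A) (s : S) : ℝ :=
  ∑ a, (π s).1 a * M.R s a

/-- `V^π`, the expected discounted return of `π`. -/
noncomputable def value (M : FiniteMDP S A) (π : Policy S A) : S → ℝ :=
  discountedSum M.γ (M.trans π) (M.rew π)

/-- `V^*`, the optimal value. -/
noncomputable def optValue (M : FiniteMDP S A) (s : S) : ℝ :=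
  ⨆ π : Policy S A, M.value π s

/-- `π` is an optimal policy. -/
def IsOptimal (M : FiniteMDP S A) (π : Policy S A) : Prop :=
  ∀ s, M.value π s = M.optValue s

/-- `‖V^* - V^{μ⇓}‖_∞` for an abstract policy `μ` with induced ground policy `μ⇓`. -/
noncomputable def policyLoss (M : FiniteMDP S A) {φ : S → X} {O : Set (MDPOption S A)}
    (μ : AbstractPolicy φ O) : ℝ :=
  ‖fun s => M.optValue s - M.value μ.ground s‖

/-- `L(φ, O)`, the value loss of the best abstract policy. -/
noncomputable def valueLoss (M : FiniteMDP S A) (φ : S → X) (O : Set (MDPOption S A)) : ℝ :=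
  ⨅ μ : AbstractPolicy φ O, M.policyLoss μ

/-- `Q^*_x(s, o)`: the expected return of executing `o` until leaving the abstract state `x`, and
acting optimally from then on; see `optionQ_eq` and `eq_optionQ` for the recursive equation that
characterizes it. -/
noncomputable def optionQ (M : FiniteMDP S A) (φ : S → X) (x : X) (o : MDPOption S A) : S → ℝ :=
  discountedSum M.γ (Matrix.of fun s s' => if φ s' = x then M.trans o.π s s' else 0)
    fun s => M.rew o.π s + M.γ * ∑ s', if φ s' = x then 0 else M.trans o.π s s' * M.optValue s'

/-- One step of `o` after which `o` has not terminated. -/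
noncomputable def contTrans (M : FiniteMDP S A) (o : MDPOption S A) : Matrix S S ℝ :=
  Matrix.of fun s s' => M.trans o.π s s' * (1 - (o.β s' : ℝ))

/-- `p(s', k ∣ s, o)`: the probability that `o`, started in `s`, terminates in `s'` after
exactly `k` steps. -/
noncomputable def termProb (M : FiniteMDP S A) (o : MDPOption S A) : ℕ → S → S → ℝ
  | 0, _, _ => 0
  | k + 1, s, s' => ∑ u, (M.contTrans o ^ k) s u * M.trans o.π u s' * (o.β s' : ℝ)

/-- The multi-time transition model `T_{s,o}^{s'} = Σ_k γ^k p(s', k ∣ s, o)`. -/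
noncomputable def multiTimeTrans (M : FiniteMDP S A) (o : MDPOption S A) (s s' : S) : ℝ :=
  ∑' k : ℕ, M.γ ^ k * M.termProb o k s s'

/-- The option reward model `R_{s,o} = E[r_1 + γ r_2 + ⋯ + γ^{k-1} r_k]`, with `k` the number of
steps until `o` terminates. -/
noncomputable def multiTimeRew (M : FiniteMDP S A) (o : MDPOption S A) : S → ℝ :=
  discountedSum M.γ (M.contTrans o) (M.rew o.π)

/-- The one-step abstract transition function `T_φ(y ∣ x, o)`. -/
noncomputable def absTrans (M : FiniteMDP S A) (φ : S → X) (w : S → ℝ) (x : X)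
    (o : MDPOption S A) (y : X) : ℝ :=
  ∑ s with φ s = x, w s * ∑ s' with φ s' = y, ∑ a, (o.π s).1 a * (M.T s a).1 s'

/-- The one-step abstract reward function `R_φ(x, o)`. -/
noncomputable def absRew (M : FiniteMDP S A) (φ : S → X) (w : S → ℝ) (x : X)
    (o : MDPOption S A) : ℝ :=
  ∑ s with φ s = x, w s * M.rew o.π s

/-- `K_p`, the maximal transition discrepancy between ground and abstract model. -/
noncomputable def Kp (M : FiniteMDP S A) {φ : S → X} {O : Set (MDPOption S A)} (w : S → ℝ)
    (μ : AbstractPolicy φ O) : ℝ :=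
  ⨆ p : S × A, ∑ y, |(∑ s' with φ s' = y, (M.T p.1 p.2).1 s')
    - M.absTrans φ w (φ p.1) (μ.1 (φ p.1)) y|

/-- `K_r`, the maximal reward discrepancy between ground and abstract model. -/
noncomputable def Kr (M : FiniteMDP S A) {φ : S → X} {O : Set (MDPOption S A)} (w : S → ℝ)
    (μ : AbstractPolicy φ O) : ℝ :=
  ⨆ p : S × A, |M.R p.1 p.2 - M.absRew φ w (φ p.1) (μ.1 (φ p.1))|

/-- Similar `Q^*`: each abstract state has an option whose `Q^*` is `ε`-close to that of the
option executing the optimal policy `πs`. -/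
def SimilarQ (M : FiniteMDP S A) (φ : S → X) (O : Set (MDPOption S A)) (πs : Policy S A)
    (ε : ℝ) : Prop :=
  ∀ x, ∃ o ∈ O, IsRelativeTo φ x o ∧ ∀ s, φ s = x →
    |M.optionQ φ x (relativeOption φ πs x) s - M.optionQ φ x o s| ≤ ε

/-- Similar multi-time models. -/
def SimilarModels (M : FiniteMDP S A) (φ : S → X) (O : Set (MDPOption S A)) (πs : Policy S A)
    (εT εR : ℝ) : Prop :=
  ∀ x, ∃ o ∈ O, IsRelativeTo φ x o ∧ ∀ s, φ s = x →
    (∀ s', |M.multiTimeTrans (relativeOption φ πs x) s s' - M.multiTimeTrans o s s'| ≤ εT) ∧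
    |M.multiTimeRew (relativeOption φ πs x) s - M.multiTimeRew o s| ≤ εR

/-- Similar `k`-step termination distributions. -/
def SimilarKStep (M : FiniteMDP S A) (φ : S → X) (O : Set (MDPOption S A)) (πs : Policy S A)
    (τ : ℝ) : Prop :=
  ∀ x, ∃ o ∈ O, IsRelativeTo φ x o ∧ ∀ k : ℕ, ∀ s, φ s = x → ∀ s',
    |M.termProb (relativeOption φ πs x) k s s' - M.termProb o k s s'| ≤ τ

/-- Approximate MDP homomorphisms, with respect to the weighting function `w`. -/
def ApproxHomomorphism (M : FiniteMDP S A) (φ : S → X) (O : Set (MDPOption S A)) (w : S → ℝ)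
    (εp εr : ℝ) : Prop :=
  ∀ μ : AbstractPolicy φ O, M.Kp w μ ≤ εp ∧ M.Kr w μ ≤ εr

/-- A goal-based MDP with goal states `G`: reward one in goal states and zero elsewhere, the
episode ends after the reward in a goal state, and each goal state is alone in its abstract
state. -/
def IsGoalBased (M : FiniteMDP S A) (φ : S → X) (G : Finset S) : Prop :=
  (∀ s a, M.R s a = if s ∈ G then 1 else 0) ∧ M.terminal = G ∧
    ∀ g ∈ G, ∀ s, s ≠ g → φ g ≠ φ s

theorem trans_isSubstochastic (M : FiniteMDP S A) (π : Policy S A) :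
    IsSubstochastic (M.trans π) := by
  refine ⟨fun s s' => ?_, fun s => ?_⟩
  · simp only [trans, Matrix.of_apply]
    split_ifs
    · exact le_rfl
    · exact Finset.sum_nonneg fun a _ => mul_nonneg ((π s).2.1 a) ((M.T s a).2.1 s')
  · simp only [trans, Matrix.of_apply]
    split_ifs
    · simp
    · rw [Finset.sum_comm]
      simp only [← Finset.mul_sum]
      have h : ∀ a, ∑ s', (M.T s a).1 s' = 1 := fun a => (M.T s a).2.2
      simp only [h, mul_one]
      exact (π s).2.2.le

/-- The Bellman equation of `V^π`. -/
theorem value_eq (M : FiniteMDP S A) (π : Policy S A) (s : S) :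
    M.value π s = M.rew π s + M.γ * ∑ s', M.trans π s s' * M.value π s' :=
  discountedSum_eq M.γ_nonneg M.γ_lt_one (M.trans_isSubstochastic π) _ s

/-- The supremum that defines `V^*` is over a bounded set. -/
theorem bddAbove_value (M : FiniteMDP S A) (s : S) :
    BddAbove (Set.range fun π : Policy S A => M.value π s) := by
  obtain ⟨B, hB⟩ : ∃ B, ∀ s a, |M.R s a| ≤ B :=
    ⟨‖M.R‖, fun s a => (norm_le_pi_norm (M.R s) a).trans (norm_le_pi_norm M.R s)⟩
  refine ⟨∑' t : ℕ, M.γ ^ t * |B|, ?_⟩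
  rintro _ ⟨π, rfl⟩
  have hr : ∀ s, |M.rew π s| ≤ |B| := fun s => by
    calc |M.rew π s| ≤ ∑ a, |(π s).1 a * M.R s a| := Finset.abs_sum_le_sum_abs _ _
      _ ≤ ∑ a, (π s).1 a * |B| := by
          refine Finset.sum_le_sum fun a _ => ?_
          rw [abs_mul, abs_of_nonneg ((π s).2.1 a)]
          exact mul_le_mul_of_nonneg_left ((hB s a).trans (le_abs_self B)) ((π s).2.1 a)
      _ = |B| := by rw [← Finset.sum_mul, (π s).2.2, one_mul]
  have hP := M.trans_isSubstochastic π
  refine (summable_discountedSum M.γ_nonneg M.γ_lt_one hP _ s).tsum_le_tsum (fun t => ?_)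
    ((summable_geometric_of_lt_one M.γ_nonneg M.γ_lt_one).mul_right |B|)
  exact mul_le_mul_of_nonneg_left
    ((le_abs_self _).trans (hP.abs_pow_mulVec_le (abs_nonneg B) hr t s))
    (pow_nonneg M.γ_nonneg t)

theorem restrict_isSubstochastic (M : FiniteMDP S A) (φ : S → X) (x : X) (π : Policy S A) :
    IsSubstochastic (Matrix.of fun s s' => if φ s' = x then M.trans π s s' else 0) := by
  have h := M.trans_isSubstochastic π
  refine ⟨fun s s' => ?_, fun s => ?_⟩
  · simp only [Matrix.of_apply]
    split_ifs
    · exact h.1 s s'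
    · exact le_rfl
  · refine le_trans (Finset.sum_le_sum fun s' _ => ?_) (h.2 s)
    simp only [Matrix.of_apply]
    split_ifs
    · exact le_rfl
    · exact h.1 s s'

/-- The recursive equation of `Q^*_x(·, o)`. -/
theorem optionQ_eq (M : FiniteMDP S A) (φ : S → X) (x : X) (o : MDPOption S A) (s : S) :
    M.optionQ φ x o s = M.rew o.π s + M.γ * ∑ s', M.trans o.π s s' *
      (if φ s' = x then M.optionQ φ x o s' else M.optValue s') := by
  unfold optionQ
  rw [discountedSum_eq M.γ_nonneg M.γ_lt_one (M.restrict_isSubstochastic φ x o.π), add_assoc,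
    ← mul_add, ← Finset.sum_add_distrib]
  congr 2
  refine Finset.sum_congr rfl fun s' _ => ?_
  by_cases h : φ s' = x <;> simp [h]

/-- The recursive equation determines `Q^*_x(·, o)`. -/
theorem eq_optionQ (M : FiniteMDP S A) (φ : S → X) (x : X) (o : MDPOption S A) (q : S → ℝ)
    (hq : ∀ s, q s = M.rew o.π s + M.γ * ∑ s', M.trans o.π s s' *
      (if φ s' = x then q s' else M.optValue s')) : q = M.optionQ φ x o := by
  refine eq_discountedSum M.γ_nonneg M.γ_lt_one (M.restrict_isSubstochastic φ x o.π) _ q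
    fun s => ?_
  rw [hq s, add_assoc, ← mul_add, ← Finset.sum_add_distrib]
  congr 2
  refine Finset.sum_congr rfl fun s' _ => ?_
  by_cases h : φ s' = x <;> simp [h]

end FiniteMDP

set_option linter.unusedSectionVars false

/-! Every bound is a fixed-point estimate: an error bounded pointwise by `a` plus `γ` times its own
sup norm has norm at most `a / (1 - γ)`.

The first three cases rest on `policyLoss_le_of_optionQ`. Let `W s` be the return of running the
chosen option until it leaves the class of `s` and acting optimally afterwards. One step of the
induced policy compares `W` with its value `V`: inside the class the gap is again `W - V`, outside
it is `V^* - V`, whence `‖W - V‖ ≤ γ ‖V^* - V‖`. If `W` is `ε`-close to `V^*`, then `‖V^* - V‖ ≤ ε +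
γ ‖V^* - V‖`. Running `π^*` in a class and then acting optimally has value exactly `V^*`, so
similarity of `Q^*` is precisely this closeness. Similar models reduce to it through `Q^* = R + ∑ T
V^*`. In the goal-based case the reward models agree exactly, `|V^*| ≤ 1`, and a geometric series
turns `τ` into a bound on the multi-time models.

The homomorphism case is separate. The abstract model under a fixed `μ` approximates every ground
action, so every ground policy has value within some `K` of the abstract value. Both `V^*` and the
value of `μ` are then within `K` of it, which gives `2 K`. -/

theorem pi_norm_le_div_of_contraction {ι : Type*} [Fintype ι] [Nonempty ι] {γ : ℝ} (h1 : γ < 1)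
    {a : ℝ} {f : ι → ℝ} (hf : ∀ i, |f i| ≤ a + γ * ‖f‖) : ‖f‖ ≤ a / (1 - γ) := by
  have h : ‖f‖ ≤ a + γ * ‖f‖ := (pi_norm_le_iff_of_nonempty f).2 hf
  rw [le_div_iff₀ (by linarith)]
  linarith

/-! ### Substochastic matrices and discounted sums -/

theorem IsSubstochastic.abs_sum_le {S : Type*} [Fintype S] {P : Matrix S S ℝ}
    (hP : IsSubstochastic P) {v : S → ℝ} {C : ℝ} (hC : 0 ≤ C) (hv : ∀ s, |v s| ≤ C) (s : S) :
    |∑ s', P s s' * v s'| ≤ C :=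
  hP.abs_mulVec_le hC hv s

theorem IsSubstochastic.pow_mulVec_nonneg {S : Type*} [Fintype S] [DecidableEq S]
    {P : Matrix S S ℝ} (hP : IsSubstochastic P) {c : S → ℝ} (hc : ∀ s, 0 ≤ c s) (t : ℕ) :
    ∀ s, 0 ≤ ((P ^ t) *ᵥ c) s := by
  induction t with
  | zero => simpa using hc
  | succ t ih =>
    intro s
    rw [pow_succ', ← Matrix.mulVec_mulVec]
    exact Finset.sum_nonneg fun s' _ => mul_nonneg (hP.1 s s') (ih s')

theorem discountedSum_nonneg {S : Type*} [Fintype S] [DecidableEq S] {γ : ℝ} (h0 : 0 ≤ γ)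
    {P : Matrix S S ℝ} (hP : IsSubstochastic P) {c : S → ℝ} (hc : ∀ s, 0 ≤ c s) (s : S) :
    0 ≤ discountedSum γ P c s :=
  tsum_nonneg fun t => mul_nonneg (pow_nonneg h0 t) (hP.pow_mulVec_nonneg hc t s)

theorem abs_discountedSum_le {S : Type*} [Fintype S] [DecidableEq S] [Nonempty S] {γ : ℝ}
    (h0 : 0 ≤ γ) (h1 : γ < 1) {P : Matrix S S ℝ} (hP : IsSubstochastic P) {c : S → ℝ} {C : ℝ}
    (hc : ∀ s, |c s| ≤ C) (s : S) : |discountedSum γ P c s| ≤ C / (1 - γ) := by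
  refine (norm_le_pi_norm (discountedSum γ P c) s).trans
    (pi_norm_le_div_of_contraction h1 fun i => ?_)
  rw [discountedSum_eq h0 h1 hP]
  refine (abs_add_le _ _).trans (add_le_add (hc i) ?_)
  rw [abs_mul, abs_of_nonneg h0]
  exact mul_le_mul_of_nonneg_left
    (hP.abs_sum_le (norm_nonneg _) (fun s => norm_le_pi_norm (discountedSum γ P c) s) i) h0

theorem abs_simplex_sum_le {ι : Type*} [Fintype ι] (p : stdSimplex ℝ ι) {f : ι → ℝ} {C : ℝ}
    (hf : ∀ i, |f i| ≤ C) : |∑ i, p.1 i * f i| ≤ C := by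
  calc |∑ i, p.1 i * f i| ≤ ∑ i, |p.1 i * f i| := Finset.abs_sum_le_sum_abs _ _
    _ ≤ ∑ i, p.1 i * C := by
        refine Finset.sum_le_sum fun i _ => ?_
        rw [abs_mul, abs_of_nonneg (p.2.1 i)]
        exact mul_le_mul_of_nonneg_left (hf i) (p.2.1 i)
    _ = C := by rw [← Finset.sum_mul, p.2.2, one_mul]

namespace FiniteMDP

variable {S A X : Type*} [Fintype S] [DecidableEq S] [Fintype A] [Fintype X] [DecidableEq X]

/-! ### Value loss from closeness of `Q^*` -/

theorem valueLoss_le_policyLoss (M : FiniteMDP S A) {φ : S → X} {O : Set (MDPOption S A)}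
    (μ : AbstractPolicy φ O) : M.valueLoss φ O ≤ M.policyLoss μ :=
  ciInf_le ⟨0, by rintro _ ⟨ν, rfl⟩; exact norm_nonneg _⟩ μ

/-- At `V^*` both branches of the recursion for `Q^*_x` coincide, leaving the Bellman equation of
`πs`; the recursion has only one solution. -/
theorem optionQ_relativeOption_of_isOptimal (M : FiniteMDP S A) (φ : S → X) (x : X)
    {πs : Policy S A} (h : M.IsOptimal πs) :
    M.optionQ φ x (relativeOption φ πs x) = M.optValue := by
  refine (M.eq_optionQ φ x _ _ fun s => ?_).symm
  simp only [ite_self]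
  rw [← h s, M.value_eq]
  simp only [h _]
  rfl

/-- Closeness of `Q^*` at the start states bounds the loss of the abstract policy. -/
theorem policyLoss_le_of_optionQ [Nonempty S] (M : FiniteMDP S A) {φ : S → X}
    {O : Set (MDPOption S A)} (μ : AbstractPolicy φ O) {ε : ℝ}
    (h : ∀ s, |M.optValue s - M.optionQ φ (φ s) (μ.1 (φ s)) s| ≤ ε) :
    M.policyLoss μ ≤ ε / (1 - M.γ) := by
  have h0 := M.γ_nonneg
  have h1 := M.γ_lt_one
  set V := M.value μ.ground with hV
  set W : S → ℝ := fun s => M.optionQ φ (φ s) (μ.1 (φ s)) s with hW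
  set D : ℝ := ‖fun s => M.optValue s - V s‖ with hD
  have hWV : ∀ s, W s - V s = M.γ * ∑ s', M.trans μ.ground s s' *
      (if φ s' = φ s then W s' - V s' else M.optValue s' - V s') := by
    intro s
    have e1 : M.rew (μ.1 (φ s)).π s = M.rew μ.ground s := rfl
    have e2 : ∀ s', M.trans (μ.1 (φ s)).π s s' = M.trans μ.ground s s' := fun _ => rfl
    have e3 := M.value_eq μ.ground s
    simp only [hW]
    rw [M.optionQ_eq, hV, e3, e1, add_sub_add_left_eq_sub, ← mul_sub, ← Finset.sum_sub_distrib]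
    congr 1
    refine Finset.sum_congr rfl fun s' _ => ?_
    rw [e2, ← mul_sub]
    -- Inside the class of `s` the option used by `W s'` is the one used at `s`, so the recursion
    -- closes up on `W`.
    by_cases hs : φ s' = φ s
    · simp [hs]
    · simp [hs]
  have hle : ‖W - V‖ ≤ M.γ * max ‖W - V‖ D := by
    refine (pi_norm_le_iff_of_nonempty _).2 fun s => ?_
    rw [Pi.sub_apply, hWV s, Real.norm_eq_abs, abs_mul, abs_of_nonneg h0]
    refine mul_le_mul_of_nonneg_left ((M.trans_isSubstochastic _).abs_sum_le
      (le_max_of_le_left (norm_nonneg _)) (fun s' => ?_) s) h0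
    split_ifs
    · exact le_max_of_le_left (norm_le_pi_norm (W - V) s')
    · exact le_max_of_le_right (norm_le_pi_norm (fun s => M.optValue s - V s) s')
  -- If the maximum is `‖W - V‖` itself, then `γ < 1` forces it to vanish.
  have hWD : ‖W - V‖ ≤ M.γ * D := by
    rcases le_total ‖W - V‖ D with hc | hc
    · rwa [max_eq_right hc] at hle
    · rw [max_eq_left hc] at hle
      have hz : ‖W - V‖ = 0 := by nlinarith [norm_nonneg (W - V)]
      rw [hz]
      exact mul_nonneg h0 (norm_nonneg _)
  refine pi_norm_le_div_of_contraction h1 fun s => ?_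
  have e : M.optValue s - V s = (M.optValue s - W s) + (W s - V s) := by ring
  calc |M.optValue s - V s| ≤ |M.optValue s - W s| + |W s - V s| := by
        rw [e]; exact abs_add_le _ _
    _ ≤ ε + M.γ * D := add_le_add (h s) ((norm_le_pi_norm (W - V) s).trans hWD)

theorem exists_policyLoss_le_of_similarQ [Nonempty S] (M : FiniteMDP S A) {φ : S → X}
    {O : Set (MDPOption S A)} {πs : Policy S A} (hπ : M.IsOptimal πs) {ε : ℝ}
    (h : M.SimilarQ φ O πs ε) : ∃ μ : AbstractPolicy φ O, M.policyLoss μ ≤ ε / (1 - M.γ) := by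
  choose o ho hr hq using h
  refine ⟨⟨o, fun x => ⟨ho x, hr x⟩⟩, M.policyLoss_le_of_optionQ _ fun s => ?_⟩
  have := hq (φ s) s rfl
  rwa [M.optionQ_relativeOption_of_isOptimal φ _ hπ] at this

/-! ### Multi-time models of relative options -/

theorem contTrans_of_isRelativeTo (M : FiniteMDP S A) {φ : S → X} {x : X} {o : MDPOption S A}
    (ho : IsRelativeTo φ x o) :
    M.contTrans o = Matrix.of fun s s' => if φ s' = x then M.trans o.π s s' else 0 := by
  ext s s'
  by_cases h : φ s' = x <;> simp [contTrans, ho.2 s', h]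

theorem contTrans_isSubstochastic (M : FiniteMDP S A) {φ : S → X} {x : X} {o : MDPOption S A}
    (ho : IsRelativeTo φ x o) : IsSubstochastic (M.contTrans o) := by
  rw [M.contTrans_of_isRelativeTo ho]
  exact M.restrict_isSubstochastic φ x o.π

theorem termProb_succ (M : FiniteMDP S A) (o : MDPOption S A) (k : ℕ) (s s' : S) :
    M.termProb o (k + 1) s s' =
      ((M.contTrans o ^ k) *ᵥ fun u => M.trans o.π u s' * (o.β s' : ℝ)) s := by
  simp only [termProb, Matrix.mulVec, dotProduct, mul_assoc]

/-- An option takes at least one step, so the term `k = 0` vanishes and the series may start at `k =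
1`. This shift is the source of the factor `γ` in the bounds below. -/
theorem hasSum_multiTimeTrans (M : FiniteMDP S A) {φ : S → X} {x : X} {o : MDPOption S A}
    (ho : IsRelativeTo φ x o) (s s' : S) :
    HasSum (fun k : ℕ => M.γ ^ (k + 1) * M.termProb o (k + 1) s s')
      (M.multiTimeTrans o s s') := by
  have hs : Summable fun k : ℕ => M.γ ^ (k + 1) * M.termProb o (k + 1) s s' := by
    have := (summable_discountedSum M.γ_nonneg M.γ_lt_one (M.contTrans_isSubstochastic ho)
      (fun u => M.trans o.π u s' * (o.β s' : ℝ)) s).mul_left M.γ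
    refine this.congr fun k => ?_
    rw [termProb_succ, pow_succ]
    ring
  have hs' : Summable fun k : ℕ => M.γ ^ k * M.termProb o k s s' :=
    (summable_nat_add_iff (f := fun k : ℕ => M.γ ^ k * M.termProb o k s s') 1).1 hs
  have e : M.multiTimeTrans o s s' = ∑' k : ℕ, M.γ ^ (k + 1) * M.termProb o (k + 1) s s' := by
    have hz : M.termProb o 0 s s' = 0 := rfl
    rw [multiTimeTrans, hs'.tsum_eq_zero_add, hz, mul_zero, zero_add]
  rw [e]
  exact hs.hasSum

theorem multiTimeTrans_eq (M : FiniteMDP S A) {φ : S → X} {x : X} {o : MDPOption S A}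
    (ho : IsRelativeTo φ x o) (s s' : S) :
    M.multiTimeTrans o s s' = M.γ * discountedSum M.γ (M.contTrans o)
      (fun u => M.trans o.π u s' * (o.β s' : ℝ)) s := by
  rw [← (M.hasSum_multiTimeTrans ho s s').tsum_eq, discountedSum, ← tsum_mul_left]
  refine tsum_congr fun k => ?_
  rw [termProb_succ, pow_succ]
  ring

/-- `Q^*_x(s, o) = R_{s,o} + Σ_{s'} T_{s,o}^{s'} V^*(s')`. -/
theorem optionQ_eq_multiTime (M : FiniteMDP S A) {φ : S → X} {x : X} {o : MDPOption S A}
    (ho : IsRelativeTo φ x o) (s : S) :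
    M.optionQ φ x o s =
      M.multiTimeRew o s + ∑ s', M.multiTimeTrans o s s' * M.optValue s' := by
  have hP := M.contTrans_isSubstochastic ho
  refine (congrFun (M.eq_optionQ φ x o (fun s => M.multiTimeRew o s +
    ∑ s', M.multiTimeTrans o s s' * M.optValue s') fun s => ?_) s).symm
  have hC : ∀ s', M.contTrans o s s' = if φ s' = x then M.trans o.π s s' else 0 := fun s' => by
    rw [M.contTrans_of_isRelativeTo ho]; rfl
  -- Conditioning on the first step gives recursions for both models; together they show that the
  -- right-hand side solves the equation of `Q^*_x`.
  have hR : M.multiTimeRew o s =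
      M.rew o.π s + M.γ * ∑ u, M.contTrans o s u * M.multiTimeRew o u :=
    discountedSum_eq M.γ_nonneg M.γ_lt_one hP _ s
  have hT : ∀ s', M.multiTimeTrans o s s' = M.γ * (M.trans o.π s s' * (o.β s' : ℝ)) +
      M.γ * ∑ u, M.contTrans o s u * M.multiTimeTrans o u s' := fun s' => by
    simp only [M.multiTimeTrans_eq ho]
    conv_lhs => rw [discountedSum_eq M.γ_nonneg M.γ_lt_one hP]
    rw [mul_add]
    congr 2
    rw [Finset.mul_sum]
    exact Finset.sum_congr rfl fun u _ => by ring
  -- On arrival inside `x` only the continuation terms survive, outside `x` only the termination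
  -- term.
  have hsplit : ∀ u, M.trans o.π s u * (if φ u = x then M.multiTimeRew o u +
        ∑ s', M.multiTimeTrans o u s' * M.optValue s' else M.optValue u) =
      M.contTrans o s u * M.multiTimeRew o u + (M.trans o.π s u * (o.β u : ℝ) * M.optValue u +
        ∑ s', M.contTrans o s u * M.multiTimeTrans o u s' * M.optValue s') := fun u => by
    rw [hC, ho.2 u]
    by_cases h : φ u = x
    · simp [h, mul_add, Finset.mul_sum, mul_assoc]
    · simp [h]
  simp only [hsplit, Finset.sum_add_distrib]
  rw [Finset.sum_comm, hR]
  simp only [hT, add_mul, Finset.sum_add_distrib, Finset.mul_sum, Finset.sum_mul]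
  simp only [← mul_assoc, mul_add, Finset.mul_sum, add_assoc]

theorem abs_optionQ_sub_le [Nonempty S] (M : FiniteMDP S A) {φ : S → X} {x : X}
    {o o' : MDPOption S A} (ho : IsRelativeTo φ x o) (ho' : IsRelativeTo φ x o') {s : S}
    {εT εR C : ℝ} (hT : ∀ s', |M.multiTimeTrans o s s' - M.multiTimeTrans o' s s'| ≤ εT)
    (hR : |M.multiTimeRew o s - M.multiTimeRew o' s| ≤ εR) (hC : ∀ s', |M.optValue s'| ≤ C) :
    |M.optionQ φ x o s - M.optionQ φ x o' s| ≤ εR + Fintype.card S * (εT * C) := by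
  rw [M.optionQ_eq_multiTime ho, M.optionQ_eq_multiTime ho', add_sub_add_comm,
    ← Finset.sum_sub_distrib]
  refine (abs_add_le _ _).trans (add_le_add hR ((Finset.abs_sum_le_sum_abs _ _).trans ?_))
  rw [← nsmul_eq_mul]
  refine Finset.sum_le_card_nsmul _ _ _ fun s' _ => ?_
  rw [← sub_mul, abs_mul]
  -- `εT` is nonnegative because it bounds an absolute value.
  exact mul_le_mul (hT s') (hC s') (abs_nonneg _) ((abs_nonneg _).trans (hT s'))

theorem exists_policyLoss_le_of_similarModels [Nonempty S] (M : FiniteMDP S A) {φ : S → X}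
    {O : Set (MDPOption S A)} {πs : Policy S A} (hπ : M.IsOptimal πs) {RMax : ℝ}
    (hRM : ∀ s a, |M.R s a| ≤ RMax) {εT εR : ℝ} (h : M.SimilarModels φ O πs εT εR) :
    ∃ μ : AbstractPolicy φ O,
      M.policyLoss μ ≤ (εR + Fintype.card S * εT * RMax) / (1 - M.γ) ^ 2 := by
  have h0 := M.γ_nonneg
  have h1 : 0 < 1 - M.γ := sub_pos.2 M.γ_lt_one
  have hV : ∀ s, |M.optValue s| ≤ RMax / (1 - M.γ) := fun s => by
    rw [← hπ s]
    exact abs_discountedSum_le h0 M.γ_lt_one (M.trans_isSubstochastic πs)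
      (fun s => abs_simplex_sum_le (πs s) (hRM s)) s
  -- The sign is needed at the end, where `εR * (1 - γ)` is relaxed to `εR` to reach the common
  -- denominator `(1 - γ) ^ 2`.
  have hεR : 0 ≤ εR := by
    obtain ⟨s⟩ := ‹Nonempty S›
    obtain ⟨o, -, -, hs⟩ := h (φ s)
    exact (abs_nonneg _).trans (hs s rfl).2
  obtain ⟨μ, hμ⟩ := M.exists_policyLoss_le_of_similarQ hπ
    (ε := εR + Fintype.card S * (εT * (RMax / (1 - M.γ)))) fun x => by
      obtain ⟨o, ho, hr, hs⟩ := h x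
      exact ⟨o, ho, hr, fun s hx => M.abs_optionQ_sub_le (relativeOption_isRelativeTo φ πs x) hr
        (hs s hx).1 (hs s hx).2 hV⟩
  refine ⟨μ, hμ.trans ?_⟩
  rw [div_le_div_iff₀ h1 (by positivity)]
  have e : (εR + Fintype.card S * (εT * (RMax / (1 - M.γ)))) * (1 - M.γ) ^ 2 =
      (εR * (1 - M.γ) + Fintype.card S * εT * RMax) * (1 - M.γ) := by
    field_simp
  rw [e]
  refine mul_le_mul_of_nonneg_right ?_ h1.le
  nlinarith

/-! ### Goal-based MDPs and `k`-step distributions -/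

theorem abs_multiTimeTrans_sub_le (M : FiniteMDP S A) {φ : S → X} {x : X}
    {o o' : MDPOption S A} (ho : IsRelativeTo φ x o) (ho' : IsRelativeTo φ x o') {s s' : S}
    {τ : ℝ} (h : ∀ k, |M.termProb o k s s' - M.termProb o' k s s'| ≤ τ) :
    |M.multiTimeTrans o s s' - M.multiTimeTrans o' s s'| ≤ τ * M.γ / (1 - M.γ) := by
  have hs := (M.hasSum_multiTimeTrans ho s s').sub (M.hasSum_multiTimeTrans ho' s s')
  have hg : HasSum (fun k : ℕ => τ * M.γ * M.γ ^ k) (τ * M.γ / (1 - M.γ)) :=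
    (hasSum_geometric_of_lt_one M.γ_nonneg M.γ_lt_one).mul_left _
  rw [← hs.tsum_eq]
  refine tsum_of_norm_bounded (f := fun k : ℕ => M.γ ^ (k + 1) * M.termProb o (k + 1) s s' -
    M.γ ^ (k + 1) * M.termProb o' (k + 1) s s') hg fun k => ?_
  rw [← mul_sub, Real.norm_eq_abs, abs_mul, abs_of_nonneg (pow_nonneg M.γ_nonneg _)]
  calc M.γ ^ (k + 1) * |M.termProb o (k + 1) s s' - M.termProb o' (k + 1) s s'|
      ≤ M.γ ^ (k + 1) * τ := mul_le_mul_of_nonneg_left (h _) (pow_nonneg M.γ_nonneg _)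
    _ = τ * M.γ * M.γ ^ k := by ring

theorem IsGoalBased.rew_eq {M : FiniteMDP S A} {φ : S → X} {G : Finset S}
    (hG : M.IsGoalBased φ G) (π : Policy S A) (s : S) :
    M.rew π s = if s ∈ G then 1 else 0 := by
  simp only [rew, hG.1]
  rw [← Finset.sum_mul, (π s).2.2, one_mul]

theorem IsGoalBased.trans_eq_zero {M : FiniteMDP S A} {φ : S → X} {G : Finset S}
    (hG : M.IsGoalBased φ G) (π : Policy S A) {s : S} (hs : s ∈ G) (s' : S) :
    M.trans π s s' = 0 := by
  simp [trans, hG.2.1, hs]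

/-- The reward 1 is collected at most once, since the episode ends with it. This avoids the general
bound `1 / (1 - γ)` and saves a factor in the third case. -/
theorem IsGoalBased.abs_value_le_one {M : FiniteMDP S A} {φ : S → X} {G : Finset S}
    (hG : M.IsGoalBased φ G) (π : Policy S A) (s : S) : |M.value π s| ≤ 1 := by
  have h0 := M.γ_nonneg
  have h1 := M.γ_lt_one
  have hle : ‖M.value π‖ ≤ max 1 (M.γ * ‖M.value π‖) := by
    refine (pi_norm_le_iff_of_nonneg (le_max_of_le_left zero_le_one)).2 fun s => ?_
    rw [M.value_eq, hG.rew_eq, Real.norm_eq_abs]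
    by_cases hs : s ∈ G
    · simp [hs, hG.trans_eq_zero π hs]
    · rw [if_neg hs, zero_add, abs_mul, abs_of_nonneg h0]
      exact le_max_of_le_right (mul_le_mul_of_nonneg_left
        ((M.trans_isSubstochastic π).abs_sum_le (norm_nonneg _)
          (fun s => norm_le_pi_norm (M.value π) s) s) h0)
  refine (norm_le_pi_norm (M.value π) s).trans ?_
  rcases le_max_iff.1 hle with h | h
  · exact h
  · nlinarith [norm_nonneg (M.value π)]

/-- Until it terminates, the option stays in `x`, where it meets no payoff. -/
theorem pow_contTrans_mulVec_eq_zero (M : FiniteMDP S A) {φ : S → X} {x : X}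
    {o : MDPOption S A} (ho : IsRelativeTo φ x o) {c : S → ℝ} (hc : ∀ s, φ s = x → c s = 0)
    (t : ℕ) : ∀ s, φ s = x → ((M.contTrans o ^ t) *ᵥ c) s = 0 := by
  induction t with
  | zero => simpa using hc
  | succ t ih =>
    intro s _
    rw [pow_succ', ← Matrix.mulVec_mulVec]
    refine Finset.sum_eq_zero fun s' _ => ?_
    by_cases h : φ s' = x
    · rw [ih s' h, mul_zero]
    · simp [contTrans, ho.2 s', h]

/-- A goal is alone in its class: either `s` is a goal and the episode ends there, or `x` contains
no goal. So the reward model does not depend on the option. -/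
theorem IsGoalBased.multiTimeRew_eq {M : FiniteMDP S A} {φ : S → X} {G : Finset S}
    (hG : M.IsGoalBased φ G) {x : X} {o : MDPOption S A} (ho : IsRelativeTo φ x o) {s : S}
    (hs : φ s = x) : M.multiTimeRew o s = if s ∈ G then 1 else 0 := by
  by_cases h : s ∈ G
  · unfold multiTimeRew
    rw [discountedSum_eq M.γ_nonneg M.γ_lt_one (M.contTrans_isSubstochastic ho), hG.rew_eq]
    simp [contTrans, hG.trans_eq_zero o.π h]
  · have hc : ∀ s', φ s' = x → M.rew o.π s' = 0 := fun s' hs' => by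
      rw [hG.rew_eq, if_neg]
      intro hg
      have hne : s ≠ s' := fun e => h (e ▸ hg)
      exact hG.2.2 s' hg s hne (hs'.trans hs.symm)
    rw [if_neg h, multiTimeRew, discountedSum]
    simp [M.pow_contTrans_mulVec_eq_zero ho hc _ s hs]

theorem exists_policyLoss_le_of_similarKStep [Nonempty S] (M : FiniteMDP S A) {φ : S → X}
    {O : Set (MDPOption S A)} {πs : Policy S A} (hπ : M.IsOptimal πs) {G : Finset S}
    (hG : M.IsGoalBased φ G) {τ : ℝ} (h : M.SimilarKStep φ O πs τ) :
    ∃ μ : AbstractPolicy φ O,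
      M.policyLoss μ ≤ τ * M.γ * Fintype.card S / (1 - M.γ) ^ 2 := by
  have h1 : 1 - M.γ ≠ 0 := (sub_pos.2 M.γ_lt_one).ne'
  obtain ⟨μ, hμ⟩ := M.exists_policyLoss_le_of_similarQ hπ
    -- The `0` is the reward discrepancy, the final `1` the bound on `V^*`.
    (ε := 0 + Fintype.card S * (τ * M.γ / (1 - M.γ) * 1)) fun x => by
      obtain ⟨o, ho, hr, hs⟩ := h x
      have hr' := relativeOption_isRelativeTo φ πs x
      refine ⟨o, ho, hr, fun s hx => M.abs_optionQ_sub_le hr' hr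
        (fun s' => M.abs_multiTimeTrans_sub_le hr' hr fun k => hs k s hx s') ?_
        fun s' => hπ s' ▸ hG.abs_value_le_one πs s'⟩
      rw [hG.multiTimeRew_eq hr' hx, hG.multiTimeRew_eq hr hx, sub_self, abs_zero]
  refine ⟨μ, hμ.trans_eq ?_⟩
  field_simp
  ring

/-! ### Approximate MDP homomorphisms -/

theorem absTrans_nonneg (M : FiniteMDP S A) {φ : S → X} {w : S → ℝ} (hw : IsWeighting φ w)
    (x : X) (o : MDPOption S A) (y : X) : 0 ≤ M.absTrans φ w x o y :=
  Finset.sum_nonneg fun s _ => mul_nonneg (hw.1 s).1 <| Finset.sum_nonneg fun s' _ =>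
    Finset.sum_nonneg fun a _ => mul_nonneg ((o.π s).2.1 a) ((M.T s a).2.1 s')

theorem sum_absTrans (M : FiniteMDP S A) (φ : S → X) (w : S → ℝ) (x : X) (o : MDPOption S A) :
    ∑ y, M.absTrans φ w x o y = ∑ s with φ s = x, w s := by
  unfold absTrans
  rw [Finset.sum_comm]
  refine Finset.sum_congr rfl fun s _ => ?_
  rw [← Finset.mul_sum, Finset.sum_fiberwise, Finset.sum_comm]
  have h : ∀ a, ∑ s', (M.T s a).1 s' = 1 := fun a => (M.T s a).2.2
  simp only [← Finset.mul_sum, h, mul_one]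
  rw [(o.π s).2.2, mul_one]

/-- An abstract state without ground states has total weight 0, so the abstract chain is only
substochastic. -/
theorem _root_.IsWeighting.sum_le_one {φ : S → X} {w : S → ℝ} (hw : IsWeighting φ w) (x : X) :
    ∑ s with φ s = x, w s ≤ 1 := by
  by_cases h : ∃ s, φ s = x
  · obtain ⟨s, rfl⟩ := h
    exact (hw.2 s).le
  · rw [Finset.sum_eq_zero fun s hs => absurd ⟨s, (Finset.mem_filter.1 hs).2⟩ h]
    exact zero_le_one

/-- Two distributions pair with a function valued in `[0, C]` up to half their distance. -/
theorem _root_.abs_sum_sub_mul_le {ι : Type*} [Fintype ι] {p q v : ι → ℝ} {C ε : ℝ}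
    (hC : 0 ≤ C) (hpq : ∑ i, p i = ∑ i, q i) (hv : ∀ i, 0 ≤ v i ∧ v i ≤ C)
    (h : ∑ i, |p i - q i| ≤ ε) : |∑ i, (p i - q i) * v i| ≤ C * (ε / 2) := by
  -- Equal masses allow centring `v` at `C / 2`, which halves its sup norm.
  have e : ∑ i, (p i - q i) * v i = ∑ i, (p i - q i) * (v i - C / 2) := by
    simp only [mul_sub, Finset.sum_sub_distrib, ← Finset.sum_mul]
    rw [hpq, sub_self, zero_mul, sub_zero]
  rw [e]
  calc |∑ i, (p i - q i) * (v i - C / 2)| ≤ ∑ i, |(p i - q i) * (v i - C / 2)| :=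
        Finset.abs_sum_le_sum_abs _ _
    _ ≤ ∑ i, |p i - q i| * (C / 2) := by
        refine Finset.sum_le_sum fun i _ => ?_
        rw [abs_mul]
        refine mul_le_mul_of_nonneg_left (abs_le.2 ⟨?_, ?_⟩) (abs_nonneg _) <;>
          linarith [hv i]
    _ ≤ ε * (C / 2) := by
        rw [← Finset.sum_mul]
        exact mul_le_mul_of_nonneg_right h (by linarith)
    _ = C * (ε / 2) := by ring

/-- The value of the abstract MDP under `μ`. -/
noncomputable def absValue (M : FiniteMDP S A) {φ : S → X} {O : Set (MDPOption S A)} (w : S → ℝ)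
    (μ : AbstractPolicy φ O) : X → ℝ :=
  discountedSum M.γ (Matrix.of fun x y => M.absTrans φ w x (μ.1 x) y)
    fun x => M.absRew φ w x (μ.1 x)

theorem absTrans_isSubstochastic (M : FiniteMDP S A) {φ : S → X} {O : Set (MDPOption S A)}
    {w : S → ℝ} (hw : IsWeighting φ w) (μ : AbstractPolicy φ O) :
    IsSubstochastic (Matrix.of fun x y => M.absTrans φ w x (μ.1 x) y) :=
  ⟨fun x y => M.absTrans_nonneg hw x _ y, fun x =>
    (M.sum_absTrans φ w x (μ.1 x)).trans_le (hw.sum_le_one x)⟩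

theorem absRew_mem_Icc [Nonempty S] [Nonempty A] (M : FiniteMDP S A) {φ : S → X} {w : S → ℝ}
    (hw : IsWeighting φ w) {RMax : ℝ} (hR : ∀ s a, 0 ≤ M.R s a ∧ M.R s a ≤ RMax) (x : X)
    (o : MDPOption S A) : M.absRew φ w x o ∈ Set.Icc 0 RMax := by
  have hRM : 0 ≤ RMax :=
    (hR (Classical.arbitrary S) (Classical.arbitrary A)).1.trans (hR _ _).2
  have hr0 : ∀ s, 0 ≤ M.rew o.π s := fun s =>
    Finset.sum_nonneg fun a _ => mul_nonneg ((o.π s).2.1 a) (hR s a).1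
  have hr1 : ∀ s, M.rew o.π s ≤ RMax := fun s =>
    (le_abs_self _).trans <| abs_simplex_sum_le (o.π s) fun a => by
      rw [abs_of_nonneg (hR s a).1]; exact (hR s a).2
  refine ⟨Finset.sum_nonneg fun s _ => mul_nonneg (hw.1 s).1 (hr0 s), ?_⟩
  calc M.absRew φ w x o ≤ ∑ s with φ s = x, w s * RMax :=
        Finset.sum_le_sum fun s _ => mul_le_mul_of_nonneg_left (hr1 s) (hw.1 s).1
    _ ≤ 1 * RMax := by
        rw [← Finset.sum_mul]
        exact mul_le_mul_of_nonneg_right (hw.sum_le_one x) hRM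
    _ = RMax := one_mul _

/-- The value of any ground policy is close to the abstract value. -/
theorem abs_value_sub_absValue_le [Nonempty S] [Nonempty A] (M : FiniteMDP S A) {φ : S → X}
    {O : Set (MDPOption S A)} {w : S → ℝ} (hw : IsWeighting φ w) (ht : M.terminal = ∅)
    {RMax : ℝ} (hR : ∀ s a, 0 ≤ M.R s a ∧ M.R s a ≤ RMax) (μ : AbstractPolicy φ O) {εp εr : ℝ}
    (hp : M.Kp w μ ≤ εp) (hr : M.Kr w μ ≤ εr) (π : Policy S A) (s : S) :
    |M.value π s - M.absValue w μ (φ s)| ≤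
      (εr + M.γ * RMax / (1 - M.γ) * (εp / 2)) / (1 - M.γ) := by
  have h0 := M.γ_nonneg
  have h1 : 0 < 1 - M.γ := sub_pos.2 M.γ_lt_one
  have hX : Nonempty X := ⟨φ s⟩
  have hRM : 0 ≤ RMax := (hR s (Classical.arbitrary A)).1.trans (hR _ _).2
  have hP := M.absTrans_isSubstochastic hw μ
  have hrew := fun x => M.absRew_mem_Icc hw hR x (μ.1 x)
  set v := M.absValue w μ with hv
  have hv0 : ∀ y, 0 ≤ v y ∧ v y ≤ RMax / (1 - M.γ) := fun y =>
    ⟨discountedSum_nonneg h0 hP (fun x => (hrew x).1) y, (le_abs_self _).trans <|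
      abs_discountedSum_le h0 M.γ_lt_one hP
        (fun x => by rw [abs_of_nonneg (hrew x).1]; exact (hrew x).2) y⟩
  have hp' : ∀ s a, ∑ y, |(∑ s' with φ s' = y, (M.T s a).1 s')
      - M.absTrans φ w (φ s) (μ.1 (φ s)) y| ≤ εp := fun s a =>
    (le_ciSup (f := fun p : S × A => ∑ y, |(∑ s' with φ s' = y, (M.T p.1 p.2).1 s')
      - M.absTrans φ w (φ p.1) (μ.1 (φ p.1)) y|) (Set.finite_range _).bddAbove (s, a)).trans hp
  have hr' : ∀ s a, |M.R s a - M.absRew φ w (φ s) (μ.1 (φ s))| ≤ εr := fun s a =>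
    (le_ciSup (f := fun p : S × A => |M.R p.1 p.2 - M.absRew φ w (φ p.1) (μ.1 (φ p.1))|)
      (Set.finite_range _).bddAbove (s, a)).trans hr
  set d : S → ℝ := fun s => M.value π s - v (φ s) with hd
  refine (norm_le_pi_norm d s).trans
    (pi_norm_le_div_of_contraction M.γ_lt_one fun s => ?_)
  have hbell : v (φ s) = M.absRew φ w (φ s) (μ.1 (φ s)) +
      M.γ * ∑ y, M.absTrans φ w (φ s) (μ.1 (φ s)) y * v y :=
    discountedSum_eq h0 M.γ_lt_one hP _ (φ s)
  have hval : M.value π s = ∑ a, (π s).1 a *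
      (M.R s a + M.γ * ∑ s', (M.T s a).1 s' * M.value π s') := by
    rw [M.value_eq]
    simp only [rew, trans, ht, Matrix.of_apply, Finset.notMem_empty, if_false, mul_add,
      Finset.sum_add_distrib, Finset.sum_mul, Finset.mul_sum]
    rw [Finset.sum_comm]
    congr 1
    exact Finset.sum_congr rfl fun a _ => Finset.sum_congr rfl fun s' _ => by ring
  -- The gap splits action by action into the reward error, the propagated gap `d`, and the
  -- transition error paired with `v`. The error bounds hold for every action, so `π` may be
  -- arbitrary.
  have hdec : d s = ∑ a, (π s).1 a * ((M.R s a - M.absRew φ w (φ s) (μ.1 (φ s))) +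
      M.γ * (∑ s', (M.T s a).1 s' * d s' + ∑ y, ((∑ s' with φ s' = y, (M.T s a).1 s')
        - M.absTrans φ w (φ s) (μ.1 (φ s)) y) * v y)) := by
    have hc : v (φ s) = ∑ a, (π s).1 a * v (φ s) := by
      rw [← Finset.sum_mul, (π s).2.2, one_mul]
    simp only [hd]
    rw [hval, hc, ← Finset.sum_sub_distrib]
    refine Finset.sum_congr rfl fun a _ => ?_
    have hfib : ∑ y, (∑ s' with φ s' = y, (M.T s a).1 s') * v y =
        ∑ s', (M.T s a).1 s' * v (φ s') := by
      rw [← Finset.sum_fiberwise Finset.univ φ]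
      refine Finset.sum_congr rfl fun y _ => ?_
      rw [Finset.sum_mul]
      exact Finset.sum_congr rfl fun s' hs' => by rw [(Finset.mem_filter.1 hs').2]
    simp only [sub_mul, mul_sub, Finset.sum_sub_distrib, hfib]
    rw [hbell]
    ring
  rw [hdec]
  refine abs_simplex_sum_le (π s) fun a => ?_
  -- Both masses are 1, as the class of `s` is inhabited; the centring argument requires this
  -- equality.
  have hsum : ∑ y, ∑ s' with φ s' = y, (M.T s a).1 s' =
      ∑ y, M.absTrans φ w (φ s) (μ.1 (φ s)) y := by
    rw [Finset.sum_fiberwise, M.sum_absTrans, hw.2 s]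
    exact (M.T s a).2.2
  have hA := abs_sum_sub_mul_le (div_nonneg hRM h1.le) hsum hv0 (hp' s a)
  have hB := abs_simplex_sum_le (M.T s a) (f := d) (fun s' => norm_le_pi_norm d s')
  calc _ ≤ εr + M.γ * (‖d‖ + RMax / (1 - M.γ) * (εp / 2)) := by
        refine (abs_add_le _ _).trans (add_le_add (hr' s a) ?_)
        rw [abs_mul, abs_of_nonneg h0]
        exact mul_le_mul_of_nonneg_left ((abs_add_le _ _).trans (add_le_add hB hA)) h0
    _ = _ := by ring

theorem policyLoss_le_of_Kp_le_of_Kr_le [Nonempty S] [Nonempty A] (M : FiniteMDP S A)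
    {φ : S → X} {O : Set (MDPOption S A)} {w : S → ℝ} (hw : IsWeighting φ w)
    (ht : M.terminal = ∅) {RMax : ℝ} (hR : ∀ s a, 0 ≤ M.R s a ∧ M.R s a ≤ RMax)
    (μ : AbstractPolicy φ O) {εp εr : ℝ} (hp : M.Kp w μ ≤ εp) (hr : M.Kr w μ ≤ εr) :
    M.policyLoss μ ≤ 2 / (1 - M.γ) * (εr + M.γ * RMax / (1 - M.γ) * (εp / 2)) := by
  have hclose := M.abs_value_sub_absValue_le hw ht hR μ hp hr
  set K := (εr + M.γ * RMax / (1 - M.γ) * (εp / 2)) / (1 - M.γ) with hK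
  have e : 2 / (1 - M.γ) * (εr + M.γ * RMax / (1 - M.γ) * (εp / 2)) = 2 * K := by
    rw [hK]; ring
  rw [e]
  refine (pi_norm_le_iff_of_nonempty _).2 fun s => ?_
  have : Nonempty (Policy S A) := ⟨μ.ground⟩
  -- The abstract value of `μ` is within `K` of every policy's value, so it also controls the
  -- supremum.
  have hup : M.optValue s ≤ M.absValue w μ (φ s) + K :=
    ciSup_le fun π => by linarith [(abs_le.1 (hclose π s)).2]
  have hlow : M.value μ.ground s ≤ M.optValue s := le_ciSup (M.bddAbove_value s) μ.ground
  have hμ := abs_le.1 (hclose μ.ground s)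
  rw [Real.norm_eq_abs, abs_of_nonneg (sub_nonneg.2 hlow)]
  linarith [hμ.1]

end FiniteMDP

theorem mainTheorem2 {S A X : Type*} [Fintype S] [DecidableEq S] [Nonempty S]
    [Fintype A] [Nonempty A] [Fintype X] [DecidableEq X]
    (M : FiniteMDP S A) (φ : S → X) (O : Set (MDPOption S A)) (hO : IsRelativeOptionSet φ O) :
    -- similar optimal Q-functions
    (∀ πs : Policy S A, M.IsOptimal πs → ∀ εQ : ℝ, M.SimilarQ φ O πs εQ →
      M.valueLoss φ O ≤ εQ / (1 - M.γ) ∧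
      ∃ μ : AbstractPolicy φ O, M.policyLoss μ ≤ εQ / (1 - M.γ)) ∧
    -- similar multi-time models
    (∀ πs : Policy S A, M.IsOptimal πs → ∀ RMax : ℝ, (∀ s a, |M.R s a| ≤ RMax) →
      ∀ εT εR : ℝ, M.SimilarModels φ O πs εT εR →
      M.valueLoss φ O ≤ (εR + Fintype.card S * εT * RMax) / (1 - M.γ) ^ 2 ∧
      ∃ μ : AbstractPolicy φ O,
        M.policyLoss μ ≤ (εR + Fintype.card S * εT * RMax) / (1 - M.γ) ^ 2) ∧
    -- similar k-step termination distributions, in goal-based MDPs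
    (∀ πs : Policy S A, M.IsOptimal πs → ∀ G : Finset S, M.IsGoalBased φ G →
      ∀ τ : ℝ, M.SimilarKStep φ O πs τ →
      M.valueLoss φ O ≤ τ * M.γ * Fintype.card S / (1 - M.γ) ^ 2 ∧
      ∃ μ : AbstractPolicy φ O,
        M.policyLoss μ ≤ τ * M.γ * Fintype.card S / (1 - M.γ) ^ 2) ∧
    -- approximate MDP homomorphisms
    (M.terminal = ∅ → ∀ RMax : ℝ, (∀ s a, 0 ≤ M.R s a ∧ M.R s a ≤ RMax) →
      ∀ w : S → ℝ, IsWeighting φ w → ∀ εp εr : ℝ, M.ApproxHomomorphism φ O w εp εr →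
      M.valueLoss φ O ≤ 2 / (1 - M.γ) * (εr + M.γ * RMax / (1 - M.γ) * (εp / 2)) ∧
      ∃ μ : AbstractPolicy φ O,
        M.policyLoss μ ≤ 2 / (1 - M.γ) * (εr + M.γ * RMax / (1 - M.γ) * (εp / 2))) := by
  refine ⟨fun πs hπ εQ h => ?_, fun πs hπ RMax hR εT εR h => ?_, fun πs hπ G hG τ h => ?_,
    fun ht RMax hR w hw εp εr h => ?_⟩
  · obtain ⟨μ, hμ⟩ := M.exists_policyLoss_le_of_similarQ hπ h
    exact ⟨(M.valueLoss_le_policyLoss μ).trans hμ, μ, hμ⟩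
  · obtain ⟨μ, hμ⟩ := M.exists_policyLoss_le_of_similarModels hπ hR h
    exact ⟨(M.valueLoss_le_policyLoss μ).trans hμ, μ, hμ⟩
  · obtain ⟨μ, hμ⟩ := M.exists_policyLoss_le_of_similarKStep hπ hG h
    exact ⟨(M.valueLoss_le_policyLoss μ).trans hμ, μ, hμ⟩
  -- Every abstract policy satisfies this bound; `hO` provides one.
  · choose o ho using hO.2.2
    have hμ := M.policyLoss_le_of_Kp_le_of_Kr_le hw ht hR (⟨o, ho⟩ : AbstractPolicy φ O)
      (h _).1 (h _).2
    exact ⟨(M.valueLoss_le_policyLoss _).trans hμ, _, hμ⟩
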